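/- Let $r>0$ and let $\rho_{AB}$ be the two-mode squeezed vacuum, i.e. the centred Gaussian state of two modes $A,B$ whose covariance matrix, in the quadrature order $(x_A,p_A,x_B,p_B)$ and normalised so that the vacuum has covariance matrix $\mathbb 1$, is $$\gamma_{AB}=\begin{pmatrix}\cosh 2r\,\mathbb 1 & \sinh 2r\,Z\\ \sinh 2r\,Z&\cosh 2r\,\mathbb 1\end{pmatrix},\qquad Z=\mathrm{diag}(1,-1).$$ Say that $A$ can steer $B$ by Gaussian measurements if there is no local hidden state model for all local Gaussian measurements, i.e. no hidden variable $\lambda$ with a probability distribution $p$, response distributions $P_\lambda(a:M_A)$ and quantum states $\sigma_\lambda$ of $B$ such that for all Gaussian measurements $M_A$ on $A$ and $M_B$ on $B$ the joint outcome distribution is $P(a,b:M_A,M_B)=\int p(d\lambda)\,P_\lambda(a:M_A)\,P^{\sigma_\lambda}(b:M_B)$, where $P^{\sigma_\lambda}(b:M_B)$ is the outcome distribution of $M_B$ in the state $\sigma_\lambda$; steering from $B$ to $A$ is defined with the roles exchanged. (a) Let mode $B$ pass through a lossy channel of transmissivity $\eta\in[0,1]$ (a beam splitter with a vacuum mode).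 The output is the centred Gaussian state with covariance matrix $$\begin{pmatrix}\cosh 2r\,\mathbb 1 & \sqrt\eta\,\sinh 2r\,Z\\ \sqrt\eta\,\sinh 2r\,Z&(\eta\cosh 2r+1-\eta)\,\mathbb 1\end{pmatrix}.$$ In this state $A$ can steer $B$ by Gaussian measurements if and only if $\eta>0$, and $B$ can steer $A$ by Gaussian measurements if and only if $\eta>\tfrac12$. (b) Let instead mode $B$ pass through an amplifying channel of gain $G\ge 1$ (a parametric amplifier with a vacuum idler). The output is the centred Gaussian state with covariance matrix $$\begin{pmatrix}\cosh 2r\,\mathbb 1 & \sqrt G\,\sinh 2r\,Z\\ \sqrt G\,\sinh 2r\,Z&(G\cosh 2r+G-1)\,\mathbb 1\end{pmatrix}.$$ In this state $A$ can steer $B$ by Gaussian measurements if and only if $G<\dfrac{2\cosh 2r}{\cosh 2r+1}$, a threshold that is less than $2$, while $B$ can steer $A$ by Gaussian measurements for every $G\ge1$. -/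

import Mathlib

open MeasureTheory ProbabilityTheory Matrix
open scoped ComplexOrder

namespace GaussianSteering

/-- The symplectic form of one mode, with quadratures ordered as `(x, p)`. -/
def omega : Matrix (Fin 2) (Fin 2) ℝ := !![0, 1; -1, 0]

/-- The symplectic form of a bipartite system with one mode on each side. -/
def omegaAB : Matrix (Fin 2 ⊕ Fin 2) (Fin 2 ⊕ Fin 2) ℝ := fromBlocks omega 0 0 omega

section General

variable {ι : Type} [Fintype ι]

/-- States of a bosonic system with canonical commutation relations
`[R j, R k] = 2 i Ω j k` (vacuum variances equal to one), represented by their characteristic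
functions `χ ξ = ⟨exp (i ∑ j, ξ j R j)⟩`. Since
`W(ξ)† W(η) = exp (i ξᵀ Ω η) W(η - ξ)` for the Weyl operators `W(ξ) = exp (i ξ · R)`, a function
is such a state iff it is normalised, continuous and has the positivity property of
the expectation of `X† X` for all finite combinations `X = ∑ j, c j W(ξ j)`. -/
structure IsState (Ω : Matrix ι ι ℝ) (χ : (ι → ℝ) → ℂ) : Prop where
  map_zero : χ 0 = 1
  continuous : Continuous χ
  posSemidef : ∀ (n : ℕ) (ξ : Fin n → ι → ℝ),
    (Matrix.of fun j k : Fin n =>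
      χ (ξ k - ξ j) * Complex.exp (Complex.I * ((ξ j ⬝ᵥ (Ω *ᵥ ξ k) : ℝ) : ℂ))).PosSemidef

/-- The characteristic function of the centred Gaussian state with covariance matrix `γ`,
`γ j k = ⟨R j R k + R k R j⟩ / 2`. -/
noncomputable def gaussianCF (γ : Matrix ι ι ℝ) (ξ : ι → ℝ) : ℂ :=
  Complex.exp (((-(1 / 2) * (ξ ⬝ᵥ (γ *ᵥ ξ)) : ℝ)) : ℂ)

/-- A Gaussian measurement with outcomes in `ℝ ^ dim`: the outcome consists of the (possibly
non-commuting) quadrature combinations given by the columns of `K`, with added Gaussian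
noise of covariance `N`; quantum mechanics requires `N + i Kᵀ Ω K ≥ 0`. For one mode, homodyne
detection of `x` is `dim = 1`, `K = (1, 0)ᵀ`, `N = 0`, heterodyne detection is `K = 1`, `N = 1`, and
the general-dyne measurement whose seed has covariance matrix `T` is `K = 1`, `N = T`. -/
structure GaussianMeasurement (Ω : Matrix ι ι ℝ) where
  dim : ℕ
  K : Matrix ι (Fin dim) ℝ
  N : Matrix (Fin dim) (Fin dim) ℝ
  posSemidef : (N.map Complex.ofReal
    + Complex.I • (Kᵀ * Ω * K).map Complex.ofReal).PosSemidef

/-- `ν` is the distribution of the outcome of the Gaussian measurement `M` on the state with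
characteristic function `χ`. -/
def IsOutcomeLaw {Ω : Matrix ι ι ℝ} (M : GaussianMeasurement Ω) (χ : (ι → ℝ) → ℂ)
    (ν : Measure (Fin M.dim → ℝ)) : Prop :=
  ∀ k : Fin M.dim → ℝ,
    ∫ b, Complex.exp (Complex.I * ((k ⬝ᵥ b : ℝ) : ℂ)) ∂ν = χ (M.K *ᵥ k) * gaussianCF M.N k

variable {κ : Type} [Fintype κ]

/-- `ν` is the joint distribution of the outcomes `(a, b)` when the two parties of a bipartite
state with characteristic function `χ` carry out the local Gaussian measurements `M` and `M'`. -/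
def IsJointOutcomeLaw {Ω : Matrix ι ι ℝ} {Ω' : Matrix κ κ ℝ}
    (M : GaussianMeasurement Ω) (M' : GaussianMeasurement Ω') (χ : (ι ⊕ κ → ℝ) → ℂ)
    (ν : Measure ((Fin M.dim → ℝ) × (Fin M'.dim → ℝ))) : Prop :=
  ∀ (k : Fin M.dim → ℝ) (l : Fin M'.dim → ℝ),
    ∫ z, Complex.exp (Complex.I * ((k ⬝ᵥ z.1 + l ⬝ᵥ z.2 : ℝ) : ℂ)) ∂ν
      = χ (Sum.elim (M.K *ᵥ k) (M'.K *ᵥ l)) * (gaussianCF M.N k * gaussianCF M'.N l)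

/-- There is a local hidden state model for Gaussian measurements, the second party being the
trusted one: `P(a, b : M, M') = ∑ λ, p(λ) P_λ(a : M) P_λ^Q(b : M')`, where the response
`P M s` of the first party to the hidden variable `s` is arbitrary, while `Q M' s` comes from a
quantum state `σ s` of the second party. -/
def HasLHSModel (Ω : Matrix ι ι ℝ) (Ω' : Matrix κ κ ℝ) (χ : (ι ⊕ κ → ℝ) → ℂ) : Prop :=
  ∃ (S : Type) (_ : MeasurableSpace S) (μ : Measure S)
    (P : ∀ M : GaussianMeasurement Ω, Kernel S (Fin M.dim → ℝ))
    (Q : ∀ M' : GaussianMeasurement Ω', Kernel S (Fin M'.dim → ℝ))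
    (σ : S → (κ → ℝ) → ℂ),
    IsProbabilityMeasure μ ∧ (∀ M, IsMarkovKernel (P M)) ∧ (∀ M', IsMarkovKernel (Q M')) ∧
    (∀ s, IsState Ω' (σ s)) ∧
    (∀ M' s, IsOutcomeLaw M' (σ s) (Q M' s)) ∧
    ∀ M M', IsJointOutcomeLaw M M' χ (μ.bind (P M ×ₖ Q M'))

end General

/-- Characteristic functions of two modes `A` and `B`, one for each party. -/
abbrev TwoModeCF : Type := (Fin 2 ⊕ Fin 2 → ℝ) → ℂ

/-- `A` can steer `B` by Gaussian measurements. -/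
def SteersAB (χ : TwoModeCF) : Prop := ¬ HasLHSModel omega omega χ

/-- `B` can steer `A` by Gaussian measurements. -/
def SteersBA (χ : TwoModeCF) : Prop := ¬ HasLHSModel omega omega fun ξ => χ (ξ ∘ Sum.swap)

/-- Covariance matrix of the two-mode squeezed vacuum with squeezing parameter `r`. -/
noncomputable def tmsvCov (r : ℝ) : Matrix (Fin 2 ⊕ Fin 2) (Fin 2 ⊕ Fin 2) ℝ :=
  fromBlocks
    !![Real.cosh (2 * r), 0; 0, Real.cosh (2 * r)]
    !![Real.sinh (2 * r), 0; 0, -Real.sinh (2 * r)]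
    !![Real.sinh (2 * r), 0; 0, -Real.sinh (2 * r)]
    !![Real.cosh (2 * r), 0; 0, Real.cosh (2 * r)]

/-- The two-mode squeezed vacuum. -/
noncomputable def tmsv (r : ℝ) : TwoModeCF := gaussianCF (tmsvCov r)

/-- The one-mode vacuum. -/
noncomputable def vacuum : (Fin 2 → ℝ) → ℂ := gaussianCF 1

/-- Lossy channel of transmissivity `η` on mode `B` (beam splitter with a vacuum mode `v`):
`x ↦ √η x + √(1 - η) x_v`, `p ↦ √η p + √(1 - η) p_v`. -/
noncomputable def lossyB (η : ℝ) (χ : TwoModeCF) : TwoModeCF := fun ξ =>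
  χ (Sum.elim (ξ ∘ Sum.inl) (√η • (ξ ∘ Sum.inr))) * vacuum (√(1 - η) • (ξ ∘ Sum.inr))

/-- Amplifying channel of gain `G` on mode `B` (parametric amplifier with a vacuum idler `v`):
`x ↦ √G x + √(G - 1) x_v`, `p ↦ √G p - √(G - 1) p_v`. -/
noncomputable def amplifyB (G : ℝ) (χ : TwoModeCF) : TwoModeCF := fun ξ =>
  χ (Sum.elim (ξ ∘ Sum.inl) (√G • (ξ ∘ Sum.inr)))
    * vacuum (√(G - 1) • ![ξ (Sum.inr 0), -ξ (Sum.inr 1)])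

/-- Covariance matrix of the two-mode squeezed vacuum after loss on mode `B`. -/
noncomputable def lossyCov (r η : ℝ) : Matrix (Fin 2 ⊕ Fin 2) (Fin 2 ⊕ Fin 2) ℝ :=
  fromBlocks
    !![Real.cosh (2 * r), 0; 0, Real.cosh (2 * r)]
    !![√η * Real.sinh (2 * r), 0; 0, -(√η * Real.sinh (2 * r))]
    !![√η * Real.sinh (2 * r), 0; 0, -(√η * Real.sinh (2 * r))]
    !![η * Real.cosh (2 * r) + 1 - η, 0; 0, η * Real.cosh (2 * r) + 1 - η]

/-- Covariance matrix of the two-mode squeezed vacuum after amplification of mode `B`. -/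
noncomputable def amplifyCov (r G : ℝ) : Matrix (Fin 2 ⊕ Fin 2) (Fin 2 ⊕ Fin 2) ℝ :=
  fromBlocks
    !![Real.cosh (2 * r), 0; 0, Real.cosh (2 * r)]
    !![√G * Real.sinh (2 * r), 0; 0, -(√G * Real.sinh (2 * r))]
    !![√G * Real.sinh (2 * r), 0; 0, -(√G * Real.sinh (2 * r))]
    !![G * Real.cosh (2 * r) + G - 1, 0; 0, G * Real.cosh (2 * r) + G - 1]

end GaussianSteering

namespace GaussianSteering

/-! ### Positive semidefinite matrices under entrywise operations. -/

section PosSemidef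

variable {n : Type*}

/-! Both channel outputs have covariance blocks a·1, b·1 and correlations d·Z, and everything
reduces to one fact: A cannot steer B exactly when the Schur complement b - d²/a is at least 1
(`hasLHSModel_standardCov_iff`).

If it is at least 1, completing the square factors the characteristic function. A point s of A's
phase space, drawn from the Gaussian law with covariance a·1, is the hidden variable. B's hidden
state is the Gaussian state with covariance (b - d²/a)·1 displaced linearly in s
(`hasLHSModel_of_eq`).

Conversely, a model obeys Reid's inequality: homodyne x and p, and estimate B's outcome by ±d/a
times A's. Given s, A's outcome carries no further information on B, so the uncertainty relation for
the hidden state bounds the two error variances, giving 2 ≤ 2(b - d²/a). Hidden states need not have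
finite moments, so the relation is derived from positivity of characteristic functions, with second
moments in `ENNReal`.

With c = cosh 2r and sinh² 2r = (c - 1)(c + 1), the thresholds are the signs of d² - a(b - 1) and,
with the roles exchanged, d² - b(a - 1). -/

theorem posSemidef_of_tendsto {M : ℕ → Matrix n n ℂ} {A : Matrix n n ℂ}
    (hM : ∀ m, (M m).PosSemidef)
    (h : ∀ i j, Filter.Tendsto (fun m => M m i j) Filter.atTop (nhds (A i j))) :
    A.PosSemidef := by
  refine ⟨?_, fun x => ?_⟩
  · ext i j
    refine tendsto_nhds_unique ((Complex.continuous_conj.tendsto _).comp (h j i)) ?_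
    refine (h i j).congr fun m => ?_
    exact ((hM m).1.apply i j).symm
  · have ht : Filter.Tendsto
        (fun m => x.sum fun i xi => x.sum fun j xj => star xi * M m i j * xj) Filter.atTop
        (nhds (x.sum fun i xi => x.sum fun j xj => star xi * A i j * xj)) := by
      refine tendsto_finsetSum _ fun i _ => tendsto_finsetSum _ fun j _ => ?_
      exact ((h i j).const_mul _).mul_const _
    exact ge_of_tendsto' ht fun m => (hM m).2 x

/-- By the Schur product theorem entrywise powers stay positive, and the exponential is a limit of
their nonnegative combinations. -/
theorem posSemidef_map_exp [Finite n] {A : Matrix n n ℂ} (hA : A.PosSemidef) :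
    (A.map Complex.exp).PosSemidef := by
  have hpow : ∀ m : ℕ, (A.map (· ^ m)).PosSemidef := by
    intro m
    induction m with
    | zero =>
      have h := posSemidef_vecMulVec_self_star (fun _ : n => (1 : ℂ))
      convert h using 1
      ext i j
      simp [vecMulVec_apply]
    | succ m ih =>
      have h : A.map (· ^ (m + 1)) = A.map (· ^ m) ⊙ A := by
        ext i j
        simp [pow_succ]
      rw [h]
      exact ih.hadamard hA
  refine posSemidef_of_tendsto
    (M := fun N => ∑ m ∈ Finset.range N, ((m.factorial : ℝ)⁻¹ : ℝ) • A.map (· ^ m)) (fun N => ?_) ?_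
  · refine posSemidef_sum _ fun m _ => (hpow m).smul (by positivity)
  · intro i j
    have h := (NormedSpace.expSeries_div_hasSum_exp (A i j)).tendsto_sum_nat
    rw [← Complex.exp_eq_exp_ℂ] at h
    refine h.congr fun N => ?_
    rw [Matrix.sum_apply]
    refine Finset.sum_congr rfl fun m _ => ?_
    simp [div_eq_inv_mul]

theorem posSemidef_congr_diagonal [Fintype n] {A : Matrix n n ℂ} (hA : A.PosSemidef) (v : n → ℂ) :
    (Matrix.of fun j k => star (v j) * A j k * v k).PosSemidef := by
  classical
  convert hA.conjTranspose_mul_mul_same (Matrix.diagonal v) using 1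
  ext j k
  simp [Matrix.diagonal_conjTranspose]

end PosSemidef

/-! ### Quantum states given by characteristic functions. -/

section States

variable {ι : Type} [Fintype ι] {Ω : Matrix ι ι ℝ}

/-- Displacing a state in phase space by `m`. -/
theorem IsState.displace {χ : (ι → ℝ) → ℂ} (h : IsState Ω χ) (m : ι → ℝ) :
    IsState Ω fun ξ => χ ξ * Complex.exp (Complex.I * ((ξ ⬝ᵥ m : ℝ) : ℂ)) where
  map_zero := by simp [h.map_zero]
  continuous := by
    have := h.continuous
    simp only [dotProduct]
    fun_prop
  posSemidef n ξ := by
    convert posSemidef_congr_diagonal (h.posSemidef n ξ)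
      (fun k => Complex.exp (Complex.I * ((ξ k ⬝ᵥ m : ℝ) : ℂ))) using 1
    ext j k
    simp only [of_apply, Complex.star_def, ← Complex.exp_conj, map_mul, Complex.conj_I,
      Complex.conj_ofReal, sub_dotProduct, Complex.ofReal_sub, mul_sub, Complex.exp_sub, neg_mul,
      Complex.exp_neg]
    ring

theorem IsState.apply_neg {χ : (ι → ℝ) → ℂ} (h : IsState Ω χ) (ξ : ι → ℝ) :
    χ (-ξ) = star (χ ξ) := by
  have h2 := (h.posSemidef 2 ![0, ξ]).1.apply 1 0
  simpa using h2.symm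

/-- Expanding the quadratic form at ξ k - ξ j writes the matrix to be tested as a diagonal
congruence of the entrywise exponential of Ξᴴ(γ + iΩ)Ξ, where Ξ has the points ξ j as columns. -/
theorem gaussianCF_isState {γ : Matrix ι ι ℝ}
    (h : (γ.map Complex.ofReal + Complex.I • Ω.map Complex.ofReal).PosSemidef) :
    IsState Ω (gaussianCF γ) where
  map_zero := by simp [gaussianCF]
  continuous := by
    unfold gaussianCF dotProduct mulVec dotProduct
    fun_prop
  posSemidef n ξ := by
    have hsymm : γᵀ = γ := by
      ext i j
      have := congrArg Complex.re (h.1.apply i j)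
      simpa using this
    have hc : ∀ x y : ι → ℝ, x ⬝ᵥ (γ *ᵥ y) = y ⬝ᵥ (γ *ᵥ x) := fun x y => by
      rw [dotProduct_mulVec, ← mulVec_transpose, hsymm, dotProduct_comm]
    let Ξ : Matrix ι (Fin n) ℂ := Matrix.of fun i j => (ξ j i : ℂ)
    have h1 := posSemidef_congr_diagonal (posSemidef_map_exp (h.conjTranspose_mul_mul_same Ξ))
      (fun k => gaussianCF γ (ξ k))
    convert h1 using 1
    ext j k
    have hre : ∀ x : ι → ℝ, star (gaussianCF γ x) = gaussianCF γ x := fun x => by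
      rw [gaussianCF, Complex.star_def, ← Complex.exp_conj, Complex.conj_ofReal]
    have hent : (Ξᴴ * (γ.map Complex.ofReal + Complex.I • Ω.map Complex.ofReal) * Ξ) j k
        = ((ξ j ⬝ᵥ (γ *ᵥ ξ k) : ℝ) : ℂ) + Complex.I * ((ξ j ⬝ᵥ (Ω *ᵥ ξ k) : ℝ) : ℂ) := by
      rw [Matrix.mul_assoc, Matrix.mul_apply]
      simp only [Matrix.mul_apply, Ξ, conjTranspose_apply, of_apply, dotProduct, mulVec,
        Complex.ofReal_sum, Complex.ofReal_mul, Finset.mul_sum, ← Finset.sum_add_distrib]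
      refine Finset.sum_congr rfl fun i _ => Finset.sum_congr rfl fun l _ => ?_
      simp
      ring
    simp only [of_apply, map_apply, hent, hre]
    simp only [gaussianCF, ← Complex.exp_add]
    congr 1
    simp only [sub_dotProduct, mulVec_sub, dotProduct_sub, hc (ξ k) (ξ j)]
    push_cast
    ring

end States

/-! ### Classical Gaussian laws and the construction of hidden state models. -/

section Classical

variable {ι κ : Type} [Fintype ι] [Fintype κ]

theorem exists_gaussianLaw {N : Matrix ι ι ℝ} (hN : N.PosSemidef) :
    ∃ ν : Measure (ι → ℝ), IsProbabilityMeasure ν ∧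
      ∀ k : ι → ℝ, ∫ w, Complex.exp (Complex.I * ((k ⬝ᵥ w : ℝ) : ℂ)) ∂ν = gaussianCF N k := by
  classical
  refine ⟨(multivariateGaussian 0 N).map WithLp.ofLp,
    Measure.isProbabilityMeasure_map (by fun_prop), fun k => ?_⟩
  rw [integral_map (by fun_prop) (Continuous.aestronglyMeasurable
    (by unfold dotProduct; fun_prop))]
  have h := charFun_multivariateGaussian (μ := 0) hN (WithLp.toLp 2 k)
  rw [charFun_apply] at h
  refine Eq.trans (integral_congr_ae (Filter.Eventually.of_forall fun x => ?_)) (h.trans ?_)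
  · simp only [EuclideanSpace.inner_eq_star_dotProduct, star_trivial]
    rw [mul_comm]
  · simp only [gaussianCF, inner_zero_right]
    congr 1
    push_cast
    ring

/-- The kernel adding independent noise with law `ν` to `L *ᵥ s`. -/
noncomputable def affineKernel (ν : Measure (κ → ℝ)) (L : Matrix κ ι ℝ) :
    Kernel (ι → ℝ) (κ → ℝ) :=
  (Kernel.id ×ₖ Kernel.const (ι → ℝ) ν).map fun p => L *ᵥ p.1 + p.2

theorem measurable_affine (L : Matrix κ ι ℝ) :
    Measurable fun p : (ι → ℝ) × (κ → ℝ) => L *ᵥ p.1 + p.2 :=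
  Continuous.measurable (by fun_prop)

instance (ν : Measure (κ → ℝ)) [IsProbabilityMeasure ν] (L : Matrix κ ι ℝ) :
    IsMarkovKernel (affineKernel ν L) :=
  Kernel.IsMarkovKernel.map _ (measurable_affine L)

theorem integral_affineKernel (ν : Measure (κ → ℝ)) [IsProbabilityMeasure ν] (L : Matrix κ ι ℝ)
    (s : ι → ℝ) (k : κ → ℝ) :
    ∫ b, Complex.exp (Complex.I * ((k ⬝ᵥ b : ℝ) : ℂ)) ∂(affineKernel ν L s)
      = Complex.exp (Complex.I * (((Lᵀ *ᵥ k) ⬝ᵥ s : ℝ) : ℂ))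
        * ∫ w, Complex.exp (Complex.I * ((k ⬝ᵥ w : ℝ) : ℂ)) ∂ν := by
  rw [affineKernel, Kernel.map_apply _ (measurable_affine L),
    integral_map (measurable_affine L).aemeasurable
      (Continuous.aestronglyMeasurable (by unfold dotProduct; fun_prop)),
    Kernel.prod_apply, Kernel.id_apply, Kernel.const_apply, Measure.dirac_prod,
    integral_map (by fun_prop) (Continuous.aestronglyMeasurable
      (by unfold dotProduct; fun_prop)), ← integral_const_mul]
  refine integral_congr_ae (Filter.Eventually.of_forall fun w => ?_)
  simp only [dotProduct_add, Complex.ofReal_add, mul_add, Complex.exp_add]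
  rw [dotProduct_mulVec, ← mulVec_transpose]

theorem gaussianCF_add (M N : Matrix ι ι ℝ) (k : ι → ℝ) :
    gaussianCF (M + N) k = gaussianCF M k * gaussianCF N k := by
  simp only [gaussianCF, ← Complex.exp_add, add_mulVec, dotProduct_add]
  congr 1
  push_cast
  ring

theorem gaussianCF_conj (M : Matrix ι ι ℝ) (K : Matrix ι κ ℝ) (k : κ → ℝ) :
    gaussianCF (Kᵀ * M * K) k = gaussianCF M (K *ᵥ k) := by
  simp only [gaussianCF]
  rw [Matrix.mul_assoc, ← mulVec_mulVec, dotProduct_mulVec k, ← mulVec_transpose,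
    transpose_transpose, ← mulVec_mulVec]

/-- On real vectors the term `I • W` contributes only an imaginary part. -/
theorem posSemidef_of_add_I_smul {N W : Matrix ι ι ℝ}
    (h : (N.map Complex.ofReal + Complex.I • W.map Complex.ofReal).PosSemidef) :
    N.PosSemidef := by
  refine .of_dotProduct_mulVec_nonneg ?_ fun x => ?_
  · ext i j
    have := congrArg Complex.re (h.1.apply i j)
    simpa using this
  · have h2 := (Complex.le_def.1 (h.dotProduct_mulVec_nonneg fun i => (x i : ℂ))).1
    simpa [dotProduct, mulVec, Finset.mul_sum, Complex.re_sum, mul_add, Finset.sum_add_distrib]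
      using h2

theorem GaussianMeasurement.noise_posSemidef {Ω : Matrix ι ι ℝ} (M : GaussianMeasurement Ω) :
    M.N.PosSemidef :=
  posSemidef_of_add_I_smul M.posSemidef

/-- If a Gaussian state becomes classical on `A` after splitting off a quantum covariance matrix
`U` on `B`, then the classical phase space point of `A` is a hidden variable. -/
theorem hasLHSModel_of_eq {Ω : Matrix ι ι ℝ} {Ω' : Matrix κ κ ℝ} {χ : (ι ⊕ κ → ℝ) → ℂ}
    {A : Matrix ι ι ℝ} {T : Matrix κ ι ℝ} {U : Matrix κ κ ℝ} (hA : A.PosSemidef)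
    (hU : (U.map Complex.ofReal + Complex.I • Ω'.map Complex.ofReal).PosSemidef)
    (hχ : ∀ ξ η, χ (Sum.elim ξ η) = gaussianCF A (ξ + Tᵀ *ᵥ η) * gaussianCF U η) :
    HasLHSModel Ω Ω' χ := by
  obtain ⟨μ, hμ, hμc⟩ := exists_gaussianLaw hA
  choose νA hνA hνAc using fun M : GaussianMeasurement Ω => exists_gaussianLaw M.noise_posSemidef
  have hU' : U.PosSemidef := posSemidef_of_add_I_smul hU
  -- B's outcome noise combines the intrinsic fluctuations of the hidden state, Kᵀ U K, with the
  -- noise of the measurement.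
  choose νB hνB hνBc using fun M : GaussianMeasurement Ω' =>
    exists_gaussianLaw ((hU'.conjTranspose_mul_mul_same M.K).add M.noise_posSemidef)
  refine ⟨ι → ℝ, inferInstance, μ, fun M => affineKernel (νA M) M.Kᵀ,
    fun M' => affineKernel (νB M') (M'.Kᵀ * T),
    fun s ξ => gaussianCF U ξ * Complex.exp (Complex.I * ((ξ ⬝ᵥ (T *ᵥ s) : ℝ) : ℂ)),
    hμ, fun M => inferInstance, fun M' => inferInstance,
    fun s => (gaussianCF_isState hU).displace _, ?_, ?_⟩
  · intro M' s k
    rw [integral_affineKernel, hνBc, gaussianCF_add, conjTranspose_eq_transpose_of_trivial,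
      gaussianCF_conj, transpose_mul, transpose_transpose, ← mulVec_mulVec,
      mulVec_transpose, ← dotProduct_mulVec]
    ring
  · intro M M' k l
    have hint : Integrable (fun z : (Fin M.dim → ℝ) × (Fin M'.dim → ℝ) =>
        Complex.exp (Complex.I * ((k ⬝ᵥ z.1 + l ⬝ᵥ z.2 : ℝ) : ℂ)))
        (μ.bind (affineKernel (νA M) M.Kᵀ ×ₖ affineKernel (νB M') (M'.Kᵀ * T))) := by
      refine Integrable.of_bound (C := 1) (Continuous.aestronglyMeasurable
        (by unfold dotProduct; fun_prop)) (Filter.Eventually.of_forall fun z => ?_)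
      rw [mul_comm, Complex.norm_exp_ofReal_mul_I]
    have hcomp := Kernel.integral_comp (κ := Kernel.const Unit μ) (a := ()) hint
    rw [Kernel.comp_apply, Kernel.const_apply] at hcomp
    rw [hcomp]
    -- Given s the two outcomes are independent with means linear in s, so s enters only through one
    -- phase, whose average is the characteristic function of A.
    have hs : ∀ s, ∫ z, Complex.exp (Complex.I * ((k ⬝ᵥ z.1 + l ⬝ᵥ z.2 : ℝ) : ℂ))
        ∂((affineKernel (νA M) M.Kᵀ ×ₖ affineKernel (νB M') (M'.Kᵀ * T)) s)
        = Complex.exp (Complex.I * (((M.K *ᵥ k + Tᵀ *ᵥ (M'.K *ᵥ l)) ⬝ᵥ s : ℝ) : ℂ))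
          * (gaussianCF U (M'.K *ᵥ l) * (gaussianCF M.N k * gaussianCF M'.N l)) := by
      intro s
      rw [Kernel.prod_apply]
      simp only [Complex.ofReal_add, mul_add, Complex.exp_add]
      rw [integral_prod_mul (fun a : Fin M.dim → ℝ => Complex.exp (Complex.I * ((k ⬝ᵥ a : ℝ) : ℂ)))
        (fun b : Fin M'.dim → ℝ => Complex.exp (Complex.I * ((l ⬝ᵥ b : ℝ) : ℂ))),
        integral_affineKernel, integral_affineKernel, hνAc, hνBc, gaussianCF_add,
        conjTranspose_eq_transpose_of_trivial, gaussianCF_conj, transpose_mul,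
        transpose_transpose, transpose_transpose, ← mulVec_mulVec, add_dotProduct,
        Complex.ofReal_add, mul_add, Complex.exp_add]
      ring
    simp only [hs]
    rw [integral_mul_const, hμc, hχ]
    ring

end Classical

/-! ### The uncertainty relation without moment assumptions. -/

section Uncertainty

/-- This is ⟨X† X⟩ ≥ 0 for X = W(e,0) - W(-e,0) + i(W(0,e) - W(0,-e)), which is 2i(sin(ex) + i
sin(ep)): a bounded version of (x - ip)(x + ip) ≥ 0. The commutator gives the left-hand side. -/
theorem IsState.re_add_re_le {χ : (Fin 2 → ℝ) → ℂ} (h : IsState omega χ) (e : ℝ) :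
    2 * (Real.sin (e ^ 2) * ((χ ![e, e]).re + (χ ![e, -e]).re))
      ≤ (1 - (χ ![2 * e, 0]).re) + (1 - (χ ![0, 2 * e]).re) := by
  have h4 := (h.posSemidef 4 ![![e, 0], ![-e, 0], ![0, e], ![0, -e]]).dotProduct_mulVec_nonneg
    ![1, -1, Complex.I, -Complex.I]
  have h5 := (Complex.le_def.1 h4).1
  have hn : ∀ a b : ℝ, χ ![-a, -b] = star (χ ![a, b]) := fun a b => by
    rw [← h.apply_neg]
    congr 1
    ext i
    fin_cases i <;> simp
  have h00 : χ ![0, 0] = 1 := by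
    rw [← h.map_zero]
    congr 1
    ext i
    fin_cases i <;> simp
  have h1 : χ ![-e, e] = star (χ ![e, -e]) := by rw [← hn, neg_neg]
  have h2 := hn e e
  have h3 : χ ![-e + -e, 0] = star (χ ![e + e, 0]) := by rw [← hn, neg_zero, neg_add]
  have h6 : χ ![0, -e + -e] = star (χ ![0, e + e]) := by rw [← hn, neg_zero, neg_add]
  have h7 : -e - e = -(e + e) := by ring
  simp [dotProduct, mulVec, Fin.sum_univ_four, omega, h1, h2, h7, h00, Complex.exp_re,
    Complex.exp_im, ← pow_two] at h5
  have h9 : ((e : ℂ) ^ 2).re = e ^ 2 := by rw [← Complex.ofReal_pow, Complex.ofReal_re]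
  have h10 : ((e : ℂ) ^ 2).im = 0 := by rw [← Complex.ofReal_pow, Complex.ofReal_im]
  simp only [h3, h6, h9, h10, neg_zero, Real.exp_zero, one_mul, Complex.star_def,
    Complex.conj_re] at h5
  rw [two_mul e]
  linarith [h5]

variable {X Y : Type*} [MeasurableSpace X] [MeasurableSpace Y]

/-- From 1 - cos θ ≤ θ²/2 at θ = 2e·f; the second moment may be infinite. -/
theorem ofReal_one_sub_re_charFun_le {μ : Measure X} [IsProbabilityMeasure μ] {f : X → ℝ}
    (hf : Measurable f) {e : ℝ} (he : 0 < e) :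
    ENNReal.ofReal
        ((1 - (∫ x, Complex.exp (Complex.I * (((2 * e) * f x : ℝ) : ℂ)) ∂μ).re) / (2 * e ^ 2))
      ≤ ∫⁻ x, ENNReal.ofReal (f x ^ 2) ∂μ := by
  have hint : Integrable (fun x => Complex.exp (Complex.I * (((2 * e) * f x : ℝ) : ℂ))) μ := by
    refine Integrable.of_bound (C := 1) (Measurable.aestronglyMeasurable (by fun_prop))
      (Filter.Eventually.of_forall fun z => ?_)
    rw [mul_comm, Complex.norm_exp_ofReal_mul_I]
  have hre : ∀ x, (Complex.exp (Complex.I * (((2 * e) * f x : ℝ) : ℂ))).re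
      = Real.cos (2 * e * f x) := fun x => by
    rw [mul_comm, Complex.exp_ofReal_mul_I_re]
  have hint' : Integrable (fun x => Real.cos (2 * e * f x)) μ := by
    simpa only [RCLike.re_to_complex, hre] using hint.re
  have h1 : (∫ x, Complex.exp (Complex.I * (((2 * e) * f x : ℝ) : ℂ)) ∂μ).re
      = ∫ x, Real.cos (2 * e * f x) ∂μ := by
    have := integral_re hint
    simp only [RCLike.re_to_complex, hre] at this
    exact this.symm
  have h2 : (1 - ∫ x, Real.cos (2 * e * f x) ∂μ) / (2 * e ^ 2)
      = ∫ x, (1 - Real.cos (2 * e * f x)) / (2 * e ^ 2) ∂μ := by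
    rw [integral_div, integral_sub (integrable_const _) hint']
    simp
  have hint2 : Integrable (fun x => (1 - Real.cos (2 * e * f x)) / (2 * e ^ 2)) μ :=
    ((integrable_const (1 : ℝ)).sub hint').div_const _
  rw [h1, h2, ofReal_integral_eq_lintegral_ofReal hint2]
  · refine lintegral_mono fun x => ENNReal.ofReal_le_ofReal ?_
    rw [div_le_iff₀ (by positivity)]
    nlinarith [Real.one_sub_sq_div_two_le_cos (x := 2 * e * f x)]
  · refine Filter.Eventually.of_forall fun x => ?_
    have := Real.cos_le_one (2 * e * f x)
    exact div_nonneg (by linarith) (by positivity)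

/-- The sum uncertainty relation for the second moments of position and momentum. -/
theorem IsState.two_le_lintegral_sq_add {χ : (Fin 2 → ℝ) → ℂ} (h : IsState omega χ)
    {μ : Measure X} [IsProbabilityMeasure μ] {ν : Measure Y} [IsProbabilityMeasure ν]
    {f : X → ℝ} {g : Y → ℝ} (hf : Measurable f) (hg : Measurable g)
    (hfχ : ∀ t : ℝ, ∫ x, Complex.exp (Complex.I * ((t * f x : ℝ) : ℂ)) ∂μ = χ ![t, 0])
    (hgχ : ∀ t : ℝ, ∫ y, Complex.exp (Complex.I * ((t * g y : ℝ) : ℂ)) ∂ν = χ ![0, t]) :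
    2 ≤ ∫⁻ x, ENNReal.ofReal (f x ^ 2) ∂μ + ∫⁻ y, ENNReal.ofReal (g y ^ 2) ∂ν := by
  -- The lower bound of `IsState.re_add_re_le` divided by 2e². Writing it with `sinc` makes it
  -- continuous at 0, where its value 2 is the desired bound.
  let F : ℝ → ℝ := fun e => Real.sinc (e ^ 2) * ((χ ![e, e]).re + (χ ![e, -e]).re)
  have hF : Continuous F := by
    have h1 : Continuous fun e : ℝ => χ ![e, e] := h.continuous.comp (by fun_prop)
    have h2 : Continuous fun e : ℝ => χ ![e, -e] := h.continuous.comp (by fun_prop)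
    exact (Real.continuous_sinc.comp (continuous_pow 2)).mul
      ((Complex.continuous_re.comp h1).add (Complex.continuous_re.comp h2))
  have h00 : χ ![0, 0] = 1 := by
    rw [← h.map_zero]
    congr 1
    ext i
    fin_cases i <;> simp
  have hF0 : F 0 = 2 := by
    simp [F, h00]
    norm_num
  have hlim : Filter.Tendsto (fun e => ENNReal.ofReal (F e)) (nhdsWithin 0 (Set.Ioi 0))
      (nhds 2) := by
    have := ((ENNReal.continuous_ofReal.comp hF).tendsto 0).mono_left
      (nhdsWithin_le_nhds (s := Set.Ioi 0))
    simpa [hF0, Function.comp_def] using this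
  refine le_of_tendsto hlim (eventually_nhdsWithin_of_forall fun e (he : 0 < e) => ?_)
  have hle := h.re_add_re_le e
  have h1 := ofReal_one_sub_re_charFun_le (μ := μ) hf he
  have h2 := ofReal_one_sub_re_charFun_le (μ := ν) hg he
  rw [hfχ] at h1
  rw [hgχ] at h2
  refine le_trans ?_ ((ENNReal.ofReal_add_le).trans (add_le_add h1 h2))
  refine ENNReal.ofReal_le_ofReal ?_
  have he2 : e ^ 2 ≠ 0 := by positivity
  simp only [F, Real.sinc_of_ne_zero he2]
  rw [← add_div, div_mul_eq_mul_div, div_le_div_iff₀ (by positivity) (by positivity)]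
  nlinarith [mul_le_mul_of_nonneg_right hle (sq_nonneg e)]

theorem IsState.two_le_lintegral_sub_sq_add {χ : (Fin 2 → ℝ) → ℂ} (h : IsState omega χ)
    {μ : Measure X} [IsProbabilityMeasure μ] {ν : Measure Y} [IsProbabilityMeasure ν]
    {f : X → ℝ} {g : Y → ℝ} (hf : Measurable f) (hg : Measurable g)
    (hfχ : ∀ t : ℝ, ∫ x, Complex.exp (Complex.I * ((t * f x : ℝ) : ℂ)) ∂μ = χ ![t, 0])
    (hgχ : ∀ t : ℝ, ∫ y, Complex.exp (Complex.I * ((t * g y : ℝ) : ℂ)) ∂ν = χ ![0, t]) (a b : ℝ) :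
    2 ≤ ∫⁻ x, ENNReal.ofReal ((f x - a) ^ 2) ∂μ + ∫⁻ y, ENNReal.ofReal ((g y - b) ^ 2) ∂ν := by
  refine (h.displace ![-a, -b]).two_le_lintegral_sq_add (hf.sub_const a) (hg.sub_const b)
    (fun t => ?_) (fun t => ?_)
  · rw [← hfχ, ← integral_mul_const]
    refine integral_congr_ae (Filter.Eventually.of_forall fun x => ?_)
    simp only [← Complex.exp_add]
    congr 1
    simp [dotProduct]
    ring
  · rw [← hgχ, ← integral_mul_const]
    refine integral_congr_ae (Filter.Eventually.of_forall fun x => ?_)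
    simp only [← Complex.exp_add]
    congr 1
    simp [dotProduct]
    ring

/-- The characteristic function identifies the law of `f` as the centred Gaussian of variance `v`.
-/
theorem lintegral_sq_of_charFun_eq {μ : Measure X} [IsProbabilityMeasure μ] {f : X → ℝ}
    (hf : Measurable f) {v : ℝ} (hv : 0 ≤ v)
    (h : ∀ t : ℝ, ∫ x, Complex.exp (Complex.I * ((t * f x : ℝ) : ℂ)) ∂μ
      = Complex.exp ((-(1 / 2) * (v * t ^ 2) : ℝ) : ℂ)) :
    ∫⁻ x, ENNReal.ofReal (f x ^ 2) ∂μ = ENNReal.ofReal v := by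
  have hprob : IsProbabilityMeasure (μ.map f) := Measure.isProbabilityMeasure_map hf.aemeasurable
  have hmap : μ.map f = gaussianReal 0 v.toNNReal := by
    refine Measure.ext_of_charFun ?_
    ext t
    rw [charFun_gaussianReal, charFun_apply_real,
      integral_map hf.aemeasurable (Continuous.aestronglyMeasurable (by fun_prop))]
    have := h t
    push_cast at this ⊢
    rw [Real.coe_toNNReal _ hv]
    simp only [mul_comm Complex.I] at this
    rw [this]
    congr 1
    ring
  have h1 : ∫⁻ x, ENNReal.ofReal (f x ^ 2) ∂μ = ∫⁻ y, ENNReal.ofReal (y ^ 2) ∂(μ.map f) := by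
    rw [lintegral_map (by fun_prop) hf]
  have hL : MemLp (fun x : ℝ => x) 2 (gaussianReal 0 v.toNNReal) := IsGaussian.memLp_two_id
  rw [h1, hmap, ← ofReal_integral_eq_lintegral_ofReal hL.integrable_sq
    (Filter.Eventually.of_forall fun x => sq_nonneg x)]
  have h2 := variance_of_integral_eq_zero (X := fun x : ℝ => x) (μ := gaussianReal 0 v.toNNReal)
    aemeasurable_id (by simp)
  rw [← h2, variance_fun_id_gaussianReal, Real.coe_toNNReal _ hv]

end Uncertainty

/-! ### Homodyne measurements and Reid's criterion. -/

section Reid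

/-- Homodyne detection of the quadrature `u 0 * x + u 1 * p`. -/
def homodyne (u : Fin 2 → ℝ) : GaussianMeasurement omega where
  dim := 1
  K := Matrix.of fun i _ => u i
  N := 0
  posSemidef := by
    -- A quadrature commutes with itself (uᵀωu = 0), so no added noise is required.
    convert PosSemidef.zero using 1
    ext i j
    simp [Matrix.mul_apply, omega, mul_comm]

theorem homodyne_K_mulVec (u : Fin 2 → ℝ) (c : ℝ) :
    ((homodyne u).K *ᵥ fun _ => c) = c • u := by
  ext i
  change ∑ j : Fin 1, u i * c = _
  simp [mul_comm]

theorem gaussianCF_homodyne_N (u : Fin 2 → ℝ) (k : Fin (homodyne u).dim → ℝ) :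
    gaussianCF (homodyne u).N k = 1 := by
  change gaussianCF 0 k = 1
  simp [gaussianCF]

theorem charFun_homodyne_pair {χ : TwoModeCF} {u w : Fin 2 → ℝ}
    {ν : Measure ((Fin 1 → ℝ) × (Fin 1 → ℝ))}
    (h : IsJointOutcomeLaw (homodyne u) (homodyne w) χ ν) (g t : ℝ) :
    ∫ z, Complex.exp (Complex.I * ((t * (z.2 0 - g * z.1 0) : ℝ) : ℂ)) ∂ν
      = χ (Sum.elim (-(g * t) • u) (t • w)) := by
  have h1 := h (fun _ => -(g * t)) (fun _ => t)
  rw [homodyne_K_mulVec, homodyne_K_mulVec, gaussianCF_homodyne_N, gaussianCF_homodyne_N, mul_one,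
    mul_one] at h1
  refine Eq.trans (integral_congr_ae (Filter.Eventually.of_forall fun z => ?_)) h1
  simp only
  congr 3
  change _ = ∑ j : Fin 1, _ + ∑ j : Fin 1, _
  simp
  ring

theorem charFun_homodyne {χ : (Fin 2 → ℝ) → ℂ} {u : Fin 2 → ℝ} {ν : Measure (Fin 1 → ℝ)}
    (h : IsOutcomeLaw (homodyne u) χ ν) (t : ℝ) :
    ∫ z, Complex.exp (Complex.I * ((t * z 0 : ℝ) : ℂ)) ∂ν = χ (t • u) := by
  have h1 := h (fun _ => t)
  rw [homodyne_K_mulVec, gaussianCF_homodyne_N, mul_one] at h1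
  refine Eq.trans (integral_congr_ae (Filter.Eventually.of_forall fun z => ?_)) h1
  simp only
  congr 3
  change _ = ∑ j : Fin 1, _
  simp

/-- Position and momentum are measured in separate runs, hence two unrelated product spaces. The
bound for fixed first outcomes a and a' is averaged over a' and then over a. -/
theorem two_le_lintegral_prod_add {X Y X' Y' : Type*} [MeasurableSpace X] [MeasurableSpace Y]
    [MeasurableSpace X'] [MeasurableSpace Y'] {μ : Measure X} {ν : Measure Y}
    {μ' : Measure X'} {ν' : Measure Y'} [IsProbabilityMeasure μ] [IsProbabilityMeasure ν]
    [IsProbabilityMeasure μ'] [IsProbabilityMeasure ν'] {F : X × Y → ENNReal}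
    {G : X' × Y' → ENNReal} (hF : Measurable F) (hG : Measurable G)
    (h : ∀ a a', 2 ≤ ∫⁻ b, F (a, b) ∂ν + ∫⁻ b, G (a', b) ∂ν') :
    2 ≤ ∫⁻ z, F z ∂(μ.prod ν) + ∫⁻ z, G z ∂(μ'.prod ν') := by
  rw [lintegral_prod _ hF.aemeasurable, lintegral_prod _ hG.aemeasurable]
  have h1 : ∀ a, 2 ≤ ∫⁻ b, F (a, b) ∂ν + ∫⁻ a', ∫⁻ b, G (a', b) ∂ν' ∂μ' := fun a => by
    have := lintegral_mono (μ := μ') (h a)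
    rwa [lintegral_add_left measurable_const, lintegral_const, lintegral_const, measure_univ,
      mul_one, mul_one] at this
  have := lintegral_mono (μ := μ) h1
  rwa [lintegral_add_right _ measurable_const, lintegral_const, lintegral_const, measure_univ,
    mul_one, mul_one] at this

/-- Reid's criterion: if the law of one quadrature pair comes from a quantum state for each value of
the hidden variable, the inferred variances obey the uncertainty relation. -/
theorem two_le_add_of_hidden_state {S : Type*} [MeasurableSpace S] {μ : Measure S}
    [IsProbabilityMeasure μ] {Px Qx Pp Qp : Kernel S (Fin 1 → ℝ)}
    (hPx : IsMarkovKernel Px) (hQx : IsMarkovKernel Qx) (hPp : IsMarkovKernel Pp)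
    (hQp : IsMarkovKernel Qp) {σ : S → (Fin 2 → ℝ) → ℂ}
    (hσ : ∀ s, IsState omega (σ s))
    (hxσ : ∀ s (t : ℝ), ∫ z, Complex.exp (Complex.I * ((t * z 0 : ℝ) : ℂ)) ∂(Qx s) = σ s ![t, 0])
    (hpσ : ∀ s (t : ℝ), ∫ z, Complex.exp (Complex.I * ((t * z 0 : ℝ) : ℂ)) ∂(Qp s) = σ s ![0, t])
    {g g' v v' : ℝ} (hv : 0 ≤ v) (hv' : 0 ≤ v')
    (hx : ∀ t : ℝ, ∫ z, Complex.exp (Complex.I * ((t * (z.2 0 - g * z.1 0) : ℝ) : ℂ))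
      ∂(μ.bind (Px ×ₖ Qx)) = Complex.exp ((-(1 / 2) * (v * t ^ 2) : ℝ) : ℂ))
    (hp : ∀ t : ℝ, ∫ z, Complex.exp (Complex.I * ((t * (z.2 0 - g' * z.1 0) : ℝ) : ℂ))
      ∂(μ.bind (Pp ×ₖ Qp)) = Complex.exp ((-(1 / 2) * (v' * t ^ 2) : ℝ) : ℂ)) :
    2 ≤ v + v' := by
  have hf : ∀ g : ℝ, Measurable fun z : (Fin 1 → ℝ) × (Fin 1 → ℝ) => z.2 0 - g * z.1 0 :=
    fun g => by fun_prop
  have hf' : ∀ g : ℝ, Measurable fun z : (Fin 1 → ℝ) × (Fin 1 → ℝ) =>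
      ENNReal.ofReal ((z.2 0 - g * z.1 0) ^ 2) := fun g => by fun_prop
  have hX := lintegral_sq_of_charFun_eq (hf g) hv hx
  have hY := lintegral_sq_of_charFun_eq (hf g') hv' hp
  rw [Measure.lintegral_bind (Kernel.aemeasurable _) (hf' _).aemeasurable] at hX hY
  -- With A's outcomes fixed, the estimates g·a and g'·a' are constants, so the shifted uncertainty
  -- relation applies to the hidden state.
  have key : ∀ s, 2 ≤
      ∫⁻ z, ENNReal.ofReal ((z.2 0 - g * z.1 0) ^ 2) ∂((Px ×ₖ Qx) s)
      + ∫⁻ z, ENNReal.ofReal ((z.2 0 - g' * z.1 0) ^ 2) ∂((Pp ×ₖ Qp) s) := fun s => by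
    rw [Kernel.prod_apply, Kernel.prod_apply]
    exact two_le_lintegral_prod_add (hf' g) (hf' g') fun a a' =>
      (hσ s).two_le_lintegral_sub_sq_add (measurable_pi_apply 0) (measurable_pi_apply 0)
        (hxσ s) (hpσ s) (g * a 0) (g' * a' 0)
  have h2 := lintegral_mono (μ := μ) key
  rw [lintegral_add_left ((hf' g).lintegral_kernel), hX, hY, lintegral_const, measure_univ,
    mul_one, ← ENNReal.ofReal_add hv hv', ENNReal.le_ofReal_iff_toReal_le (by simp)
    (by positivity)] at h2
  simpa using h2

theorem HasLHSModel.two_le {χ : TwoModeCF} (h : HasLHSModel omega omega χ) {g g' v v' : ℝ}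
    (hv : 0 ≤ v) (hv' : 0 ≤ v')
    (hx : ∀ t : ℝ, χ (Sum.elim (-(g * t) • ![1, 0]) (t • ![1, 0]))
      = Complex.exp ((-(1 / 2) * (v * t ^ 2) : ℝ) : ℂ))
    (hp : ∀ t : ℝ, χ (Sum.elim (-(g' * t) • ![0, 1]) (t • ![0, 1]))
      = Complex.exp ((-(1 / 2) * (v' * t ^ 2) : ℝ) : ℂ)) :
    2 ≤ v + v' := by
  obtain ⟨S, _, μ, P, Q, σ, _, hP, hQ, hσ, hout, hjoint⟩ := h
  exact two_le_add_of_hidden_state (hP (homodyne ![1, 0])) (hQ (homodyne ![1, 0]))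
    (hP (homodyne ![0, 1])) (hQ (homodyne ![0, 1])) hσ
    (fun s t => (charFun_homodyne (hout _ s) t).trans (by simp))
    (fun s t => (charFun_homodyne (hout _ s) t).trans (by simp)) hv hv'
    (fun t => (charFun_homodyne_pair (hjoint _ _) g t).trans (hx t))
    (fun t => (charFun_homodyne_pair (hjoint _ _) g' t).trans (hp t))

end Reid

/-! ### States in standard form: positivity and the steering criterion. -/

section StandardForm

/-- The two-mode covariance matrix in standard form with correlations `d` and `-d`. -/
noncomputable def standardCov (a b d : ℝ) : Matrix (Fin 2 ⊕ Fin 2) (Fin 2 ⊕ Fin 2) ℝ :=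
  fromBlocks !![a, 0; 0, a] !![d, 0; 0, -d] !![d, 0; 0, -d] !![b, 0; 0, b]

theorem gaussianCF_standardCov (a b d : ℝ) (ξ : Fin 2 ⊕ Fin 2 → ℝ) :
    gaussianCF (standardCov a b d) ξ = Complex.exp ((-(1 / 2) *
      (a * (ξ (.inl 0) ^ 2 + ξ (.inl 1) ^ 2) + b * (ξ (.inr 0) ^ 2 + ξ (.inr 1) ^ 2)
        + 2 * d * (ξ (.inl 0) * ξ (.inr 0) - ξ (.inl 1) * ξ (.inr 1))) : ℝ) : ℂ) := by
  rw [gaussianCF]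
  congr 2
  simp [standardCov, dotProduct, mulVec, Fintype.sum_sum_type, Fin.sum_univ_two]
  ring

theorem gaussianCF_smul_one (u : ℝ) (ξ : Fin 2 → ℝ) :
    gaussianCF (u • (1 : Matrix (Fin 2) (Fin 2) ℝ)) ξ
      = Complex.exp ((-(1 / 2) * (u * (ξ 0 ^ 2 + ξ 1 ^ 2)) : ℝ) : ℂ) := by
  rw [gaussianCF]
  congr 2
  simp [smul_mulVec, dotProduct, Fin.sum_univ_two]
  ring

theorem gaussianCF_standardCov_swap (a b d : ℝ) :
    (fun ξ : Fin 2 ⊕ Fin 2 → ℝ => gaussianCF (standardCov a b d) (ξ ∘ Sum.swap))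
      = gaussianCF (standardCov b a d) := by
  ext ξ
  rw [gaussianCF_standardCov, gaussianCF_standardCov]
  congr 2
  simp
  ring

theorem add_I_smul_omega_posSemidef {u : ℝ} (hu : 1 ≤ u) :
    ((u • (1 : Matrix (Fin 2) (Fin 2) ℝ)).map Complex.ofReal
      + Complex.I • omega.map Complex.ofReal).PosSemidef := by
  have h1 : (((u - 1 : ℝ) : ℂ) • (1 : Matrix (Fin 2) (Fin 2) ℂ)).PosSemidef :=
    PosSemidef.one.smul (by rw [Complex.zero_le_real]; linarith)
  have h2 := posSemidef_vecMulVec_self_star ![Complex.I, 1]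
  convert h1.add h2 using 1
  ext i j
  rw [Matrix.add_apply, Matrix.add_apply, vecMulVec_apply]
  fin_cases i <;> fin_cases j <;> simp [omega]

/-- In the circular vectors (1, ∓i) on A and (1, ±i) on B, γ + iΩ splits into the blocks ((a+1, d),
(d, b-1)) and ((a-1, d), (d, b+1)). Each is a rank-one matrix plus a Schur complement, nonnegative
by the determinant hypotheses; this gives the four summands. -/
theorem standardCov_add_I_smul_posSemidef {a b d : ℝ} (ha : 1 ≤ a) (hb : 1 ≤ b)
    (h1 : d ^ 2 ≤ (a + 1) * (b - 1)) (h2 : d ^ 2 ≤ (a - 1) * (b + 1)) :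
    ((standardCov a b d).map Complex.ofReal
      + Complex.I • omegaAB.map Complex.ofReal).PosSemidef := by
  have ha1 : 0 < a + 1 := by linarith
  have hb1 : 0 < b + 1 := by linarith
  have e1 : 0 ≤ b - 1 - d ^ 2 / (a + 1) := by
    rw [sub_nonneg, div_le_iff₀ ha1]
    linarith
  have e2 : 0 ≤ a - 1 - d ^ 2 / (b + 1) := by
    rw [sub_nonneg, div_le_iff₀ hb1]
    linarith
  have p : ∀ (c : ℝ) (v : Fin 2 ⊕ Fin 2 → ℂ), 0 ≤ c →
      (((c : ℝ) : ℂ) • vecMulVec v (star v)).PosSemidef := fun c v hc =>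
    (posSemidef_vecMulVec_self_star v).smul (by simpa using hc)
  have q := (((p ((1 / (2 * (a + 1)))) (Sum.elim ![a + 1, -Complex.I * (a + 1)]
      ![d, Complex.I * d]) (by positivity)).add
    (p ((1 / (2 * (b + 1)))) (Sum.elim ![d, Complex.I * d]
      ![b + 1, -Complex.I * (b + 1)]) (by positivity))).add
    (p ((b - 1 - d ^ 2 / (a + 1)) / 2) (Sum.elim ![0, 0] ![1, Complex.I]) (by positivity))).add
    (p ((a - 1 - d ^ 2 / (b + 1)) / 2) (Sum.elim ![1, Complex.I] ![0, 0]) (by positivity))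
  have hac : (a : ℂ) + 1 ≠ 0 := by exact_mod_cast ha1.ne'
  have hbc : (b : ℂ) + 1 ≠ 0 := by exact_mod_cast hb1.ne'
  convert q using 1
  ext i j
  rcases i with i | i <;> rcases j with j | j <;> fin_cases i <;> fin_cases j <;>
    simp [standardCov, omegaAB, omega, vecMulVec_apply] <;> field_simp <;>
    ring_nf <;> simp <;> ring

/-- Steerability of a standard form state is decided by the Schur complement. -/
theorem hasLHSModel_standardCov_iff {a b d : ℝ} (ha : 0 < a) (h : d ^ 2 ≤ a * b) :
    HasLHSModel omega omega (gaussianCF (standardCov a b d)) ↔ 1 ≤ b - d ^ 2 / a := by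
  constructor
  · intro hL
    have hv : 0 ≤ b - d ^ 2 / a := by
      rw [sub_nonneg, div_le_iff₀ ha]
      linarith
    -- The gains are the linear regression coefficients of B's quadratures on A's; the sign change
    -- for p comes from Z. Both errors then have variance b - d²/a.
    have := hL.two_le (g := d / a) (g' := -(d / a)) hv hv (fun t => ?_) (fun t => ?_)
    · linarith
    · rw [gaussianCF_standardCov]
      congr 2
      simp
      field_simp
      ring
    · rw [gaussianCF_standardCov]
      congr 2
      simp
      field_simp
      ring
  · intro hu
    -- Completing the square in A's variables leaves U = (b - d²/a)·1.
    refine hasLHSModel_of_eq (A := a • 1) (T := !![d / a, 0; 0, -(d / a)])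
      (PosSemidef.one.smul ha.le) (add_I_smul_omega_posSemidef hu) fun ξ η => ?_
    rw [gaussianCF_standardCov, gaussianCF_smul_one, gaussianCF_smul_one, ← Complex.exp_add,
      ← Complex.ofReal_add]
    congr 2
    simp
    field_simp
    ring

end StandardForm

/-! ### The two channels acting on the squeezed vacuum. -/

section Channels

theorem tmsvCov_eq (r : ℝ) :
    tmsvCov r = standardCov (Real.cosh (2 * r)) (Real.cosh (2 * r)) (Real.sinh (2 * r)) := rfl

theorem lossyCov_eq (r η : ℝ) : lossyCov r η = standardCov (Real.cosh (2 * r))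
    (η * Real.cosh (2 * r) + 1 - η) (√η * Real.sinh (2 * r)) := rfl

theorem amplifyCov_eq (r G : ℝ) : amplifyCov r G = standardCov (Real.cosh (2 * r))
    (G * Real.cosh (2 * r) + G - 1) (√G * Real.sinh (2 * r)) := rfl

theorem vacuum_apply (ξ : Fin 2 → ℝ) :
    vacuum ξ = Complex.exp ((-(1 / 2) * (ξ 0 ^ 2 + ξ 1 ^ 2) : ℝ) : ℂ) := by
  have := gaussianCF_smul_one 1 ξ
  rwa [one_smul, one_mul] at this

theorem lossyB_tmsv (r : ℝ) {η : ℝ} (h0 : 0 ≤ η) (h1 : η ≤ 1) :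
    lossyB η (tmsv r) = gaussianCF (lossyCov r η) := by
  ext ξ
  rw [lossyB, tmsv, tmsvCov_eq, lossyCov_eq, gaussianCF_standardCov, gaussianCF_standardCov,
    vacuum_apply, ← Complex.exp_add, ← Complex.ofReal_add]
  congr 2
  simp [mul_pow, Real.sq_sqrt h0, Real.sq_sqrt (sub_nonneg.2 h1)]
  ring

theorem amplifyB_tmsv (r : ℝ) {G : ℝ} (h : 1 ≤ G) :
    amplifyB G (tmsv r) = gaussianCF (amplifyCov r G) := by
  ext ξ
  rw [amplifyB, tmsv, tmsvCov_eq, amplifyCov_eq, gaussianCF_standardCov, gaussianCF_standardCov,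
    vacuum_apply, ← Complex.exp_add, ← Complex.ofReal_add]
  congr 2
  simp [mul_pow, Real.sq_sqrt (zero_le_one.trans h), Real.sq_sqrt (sub_nonneg.2 h)]
  ring

theorem steersAB_standardCov_iff {a b d : ℝ} (ha : 0 < a) (h : d ^ 2 ≤ a * b) :
    SteersAB (gaussianCF (standardCov a b d)) ↔ a * (b - 1) < d ^ 2 := by
  rw [SteersAB, hasLHSModel_standardCov_iff ha h, not_le, sub_lt_comm, lt_div_iff₀ ha, mul_comm]

theorem steersBA_standardCov_iff {a b d : ℝ} (hb : 0 < b) (h : d ^ 2 ≤ a * b) :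
    SteersBA (gaussianCF (standardCov a b d)) ↔ b * (a - 1) < d ^ 2 := by
  rw [SteersBA, gaussianCF_standardCov_swap]
  exact steersAB_standardCov_iff hb (by linarith)

end Channels

end GaussianSteering

/-! ### Steering thresholds. -/

theorem mainTheorem7 (r : ℝ) (hr : 0 < r) :
    (∀ η : ℝ, 0 ≤ η → η ≤ 1 →
      GaussianSteering.IsState GaussianSteering.omegaAB
        (GaussianSteering.lossyB η (GaussianSteering.tmsv r)) ∧
      GaussianSteering.lossyB η (GaussianSteering.tmsv r)
        = GaussianSteering.gaussianCF (GaussianSteering.lossyCov r η) ∧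
      (GaussianSteering.SteersAB (GaussianSteering.lossyB η (GaussianSteering.tmsv r)) ↔ 0 < η) ∧
      (GaussianSteering.SteersBA (GaussianSteering.lossyB η (GaussianSteering.tmsv r)) ↔
        1 / 2 < η)) ∧
    (∀ G : ℝ, 1 ≤ G →
      GaussianSteering.IsState GaussianSteering.omegaAB
        (GaussianSteering.amplifyB G (GaussianSteering.tmsv r)) ∧
      GaussianSteering.amplifyB G (GaussianSteering.tmsv r)
        = GaussianSteering.gaussianCF (GaussianSteering.amplifyCov r G) ∧
      (GaussianSteering.SteersAB (GaussianSteering.amplifyB G (GaussianSteering.tmsv r)) ↔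
        G < 2 * Real.cosh (2 * r) / (Real.cosh (2 * r) + 1)) ∧
      GaussianSteering.SteersBA (GaussianSteering.amplifyB G (GaussianSteering.tmsv r))) ∧
    2 * Real.cosh (2 * r) / (Real.cosh (2 * r) + 1) < 2 := by
  have hc : 1 < Real.cosh (2 * r) := Real.one_lt_cosh.2 (by positivity)
  have hs : Real.sinh (2 * r) ^ 2 = (Real.cosh (2 * r) - 1) * (Real.cosh (2 * r) + 1) := by
    rw [Real.sinh_sq]
    ring
  set c := Real.cosh (2 * r)
  have hd : ∀ x : ℝ, 0 ≤ x → (√x * Real.sinh (2 * r)) ^ 2 = x * ((c - 1) * (c + 1)) :=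
    fun x hx => by rw [mul_pow, Real.sq_sqrt hx, hs]
  have hc1 : 0 < c - 1 := by linarith
  refine ⟨fun η h0 h1 => ?_, fun G hG => ?_, ?_⟩
  · have hb : 0 ≤ η * (c - 1) := by positivity
    have hb1 : 1 ≤ η * c + 1 - η := by linarith
    have hη : 0 ≤ (1 - η) * (c - 1) := mul_nonneg (by linarith) hc1.le
    have hle1 : (√η * Real.sinh (2 * r)) ^ 2 ≤ (c + 1) * (η * c + 1 - η - 1) := by
      rw [hd η h0]
      exact le_of_eq (by ring)
    have hle2 : (√η * Real.sinh (2 * r)) ^ 2 ≤ (c - 1) * (η * c + 1 - η + 1) := by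
      rw [hd η h0]
      linarith
    -- The mean of the two preceding bounds is d² ≤ ab - 1.
    have hle : (√η * Real.sinh (2 * r)) ^ 2 ≤ c * (η * c + 1 - η) := by linarith
    rw [GaussianSteering.lossyB_tmsv r h0 h1, GaussianSteering.lossyCov_eq]
    refine ⟨GaussianSteering.gaussianCF_isState
      (GaussianSteering.standardCov_add_I_smul_posSemidef hc.le hb1 hle1 hle2), rfl, ?_, ?_⟩
    · rw [GaussianSteering.steersAB_standardCov_iff (by linarith) hle, hd η h0]
      have : η * ((c - 1) * (c + 1)) - c * (η * c + 1 - η - 1) = (c - 1) * η := by ring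
      rw [← sub_pos, this, mul_pos_iff_of_pos_left hc1]
    · rw [GaussianSteering.steersBA_standardCov_iff (by linarith) hle, hd η h0]
      have : η * ((c - 1) * (c + 1)) - (η * c + 1 - η) * (c - 1) = (c - 1) * (2 * (η - 1 / 2)) := by
        ring
      rw [← sub_pos, this, mul_pos_iff_of_pos_left hc1, mul_pos_iff_of_pos_left two_pos, sub_pos]
  · have hG0 : 0 ≤ G := by linarith
    have hb1 : 1 ≤ G * c + G - 1 := by nlinarith
    have hle1 : (√G * Real.sinh (2 * r)) ^ 2 ≤ (c + 1) * (G * c + G - 1 - 1) := by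
      rw [hd G hG0]
      nlinarith
    have hle2 : (√G * Real.sinh (2 * r)) ^ 2 ≤ (c - 1) * (G * c + G - 1 + 1) := by
      rw [hd G hG0]
      exact le_of_eq (by ring)
    have hle : (√G * Real.sinh (2 * r)) ^ 2 ≤ c * (G * c + G - 1) := by linarith
    rw [GaussianSteering.amplifyB_tmsv r hG, GaussianSteering.amplifyCov_eq]
    refine ⟨GaussianSteering.gaussianCF_isState
      (GaussianSteering.standardCov_add_I_smul_posSemidef hc.le hb1 hle1 hle2), rfl, ?_, ?_⟩
    · rw [GaussianSteering.steersAB_standardCov_iff (by linarith) hle, hd G hG0,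
        lt_div_iff₀ (by linarith), ← sub_pos, ← sub_pos (b := G * (c + 1))]
      have : G * ((c - 1) * (c + 1)) - c * (G * c + G - 1 - 1) = 2 * c - G * (c + 1) := by ring
      rw [this]
    -- Here b(a - 1) = d² - (c - 1), so the inequality is strict whatever G is.
    · rw [GaussianSteering.steersBA_standardCov_iff (by linarith) hle, hd G hG0]
      linarith
  · rw [div_lt_iff₀ (by linarith)]
    linarith
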